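/- Let $R$ be a complete, separated, right linear topological ring: a (possibly noncommutative) unital topological ring whose open right ideals form a base of neighborhoods of zero and for which the natural map $R\to\varprojlim_I R/I$, with $I$ ranging over the open right ideals, is bijective. For a set $X$, let $R[[X]]$ be the set of all infinite formal linear combinations $\sum_{x\in X}r_xx$ with $r_x\in R$ such that, for every open right ideal $I\subset R$, one has $r_x\in I$ for all but finitely many $x\in X$. The functor $X\mapsto R[[X]]$ is a monad on the category of sets, whose unit sends $x$ to $1\cdot x$ and whose multiplication $R[[R[[X]]]]\to R[[X]]$ opens the parentheses, the infinite sums of coefficients being limits of finite partial sums in $R$. A left $R$-contramodule is an algebra over this monad; $R\text{-contra}$ denotes the category of left $R$-contramodules. The free left $R$-contramodule with one generator is identified with $R$ itself, and for $a\in R$ the right multiplication ${*a}\colon R\to R$, $r\mapsto ra$, is a morphism of left $R$-contramodules. A Bass flat left $R$-contramodule is a direct limit, computed in $R\text{-contra}$, $$B=\varinjlim\bigl(R\xrightarrow{*a_1}R\xrightarrow{*a_2}R\xrightarrow{*a_3}\cdots\bigr)$$ for some sequence $a_1,a_2,a_3,\ldots$ of elements of $R$. A projective cover of an object $B$ is a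 morphism $p\colon P\to B$ with $P$ projective such that every morphism $P'\to B$ with $P'$ projective factors through $p$, and such that every endomorphism $f\colon P\to P$ with $p\circ f=p$ is an automorphism. **Corollary.** If a Bass flat left $R$-contramodule $B$ has a projective cover in $R\text{-contra}$, then $B$ is a projective object of $R\text{-contra}$. -/

import Mathlib

open CategoryTheory Limits Filter Topology

universe u v w

set_option linter.unusedSectionVars false

namespace Contra

section FormalSums

variable (R : Type u) [Ring R] [UniformSpace R]

/-- The set `R[[X]]` of infinite formal linear combinations of elements of `X` whose family of
coefficients converges to zero in the topology of `R`: for every open right ideal `I` of `R`, all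
but finitely many of the coefficients lie in `I`.
Right ideals of `R` are the submodules of `R` over the opposite ring `Rᵐᵒᵖ`. -/
def FormalSum (X : Type v) : Type (max u v) :=
  {r : X → R // ∀ I : Submodule Rᵐᵒᵖ R, IsOpen (I : Set R) → {x | r x ∉ I}.Finite}

variable {R} {X : Type v} {Y : Type w}

instance : CoeFun (FormalSum R X) (fun _ => X → R) := ⟨Subtype.val⟩

@[ext]
theorem FormalSum.ext {r s : FormalSum R X} (h : ∀ x, r x = s x) : r = s :=
  Subtype.ext (funext h)

variable [IsUniformAddGroup R] [IsLinearTopology Rᵐᵒᵖ R]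

/-- The condition in the definition of `FormalSum` is convergence to zero. -/
theorem tendsto_cofinite_zero_iff {r : X → R} :
    (∀ I : Submodule Rᵐᵒᵖ R, IsOpen (I : Set R) → {x | r x ∉ I}.Finite) ↔
      Tendsto r cofinite (𝓝 0) := by
  rw [(IsLinearTopology.hasBasis_open_submodule (M := R) Rᵐᵒᵖ).tendsto_right_iff]
  simp only [eventually_cofinite, SetLike.mem_coe]

theorem nonarchimedean : NonarchimedeanAddGroup R where
  is_nonarchimedean U hU := by
    obtain ⟨I, hI, hIU⟩ :=
      (IsLinearTopology.hasBasis_open_submodule (M := R) Rᵐᵒᵖ).mem_iff.1 hU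
    exact ⟨⟨I.toAddSubgroup, hI⟩, hIU⟩

theorem tsum_mem_openRightIdeal (I : Submodule Rᵐᵒᵖ R)
    (hI : IsOpen (I : Set R)) {f : X → R} (hf : ∀ x, f x ∈ I) : ∑' x, f x ∈ I := by
  have hc : IsClosed (I : Set R) := I.toAddSubgroup.isClosed_of_isOpen hI
  by_cases hs : Summable f
  · exact hc.mem_of_tendsto hs.hasSum (Eventually.of_forall fun s => I.sum_mem fun x _ => hf x)
  · rw [tsum_eq_zero_of_not_summable hs]
    exact I.zero_mem

theorem mul_mem_rightIdeal (I : Submodule Rᵐᵒᵖ R) {a : R} (ha : a ∈ I) (b : R) : a * b ∈ I := by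
  simpa using I.smul_mem (MulOpposite.op b) ha

/-- The "point measure" `ε_X : X → R[[X]]`, `x ↦ 1 · x`. -/
noncomputable def point (x : X) : FormalSum R X := by
  classical
  exact ⟨Pi.single x 1, fun I _ => (Set.finite_singleton x).subset fun y hy => by
    by_contra h
    exact hy (by simp [Pi.single_eq_of_ne (show y ≠ x from h)])⟩

/-- The pushforward `R[[f]] : R[[X]] → R[[Y]]`: the coefficient at `y` is the sum of
the coefficients over the fibre of `f` over `y`. -/
noncomputable def mapSum (f : X → Y) (r : FormalSum R X) : FormalSum R Y :=
  ⟨fun y => ∑' x : f ⁻¹' {y}, r x, fun I hI => ((r.2 I hI).image f).subset fun y hy => by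
    by_contra h
    refine hy (tsum_mem_openRightIdeal I hI fun x => ?_)
    by_contra hx
    exact h ⟨x, hx, x.2⟩⟩

variable [IsTopologicalRing R]

theorem finite_mul {r : X → R} {g : X → Y → R}
    (hr : ∀ I : Submodule Rᵐᵒᵖ R, IsOpen (I : Set R) → {x | r x ∉ I}.Finite)
    (hg : ∀ x, ∀ I : Submodule Rᵐᵒᵖ R, IsOpen (I : Set R) → {y | g x y ∉ I}.Finite)
    (I : Submodule Rᵐᵒᵖ R) (hI : IsOpen (I : Set R)) :
    {p : X × Y | r p.1 * g p.1 p.2 ∉ I}.Finite := by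
  have key : ∀ x, {y | r x * g x y ∉ I}.Finite := fun x => by
    have h := (tendsto_cofinite_zero_iff.1 (hg x)).const_mul (r x)
    rw [mul_zero] at h
    exact tendsto_cofinite_zero_iff.2 h I hI
  refine ((hr I hI).biUnion fun x _ => (key x).image (Prod.mk x)).subset ?_
  rintro ⟨x, y⟩ h
  exact Set.mem_biUnion (x := x) (fun hx => h (mul_mem_rightIdeal I hx _)) ⟨y, h, rfl⟩

/-- The linear extension of `g : X → R[[Y]]`, sending `∑ r_x x` to `∑ r_x g(x)`, where
the coefficients of the latter are limits of finite partial sums in `R`. -/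
noncomputable def extend (g : X → FormalSum R Y) (r : FormalSum R X) : FormalSum R Y :=
  ⟨fun y => ∑' x, r x * g x y, fun I hI =>
    ((finite_mul r.2 (fun x => (g x).2) I hI).image Prod.snd).subset fun y hy => by
      by_contra h
      refine hy (tsum_mem_openRightIdeal I hI fun x => ?_)
      by_contra hx
      exact h ⟨(x, y), hx, rfl⟩⟩

/-- The "opening of parentheses" `φ_X : R[[R[[X]]]] → R[[X]]`: the coefficient of `φ_X(Q)` at `x`
is the sum of the products `Q_q q_x` over all `q ∈ R[[X]]`. -/
noncomputable def openParens (Q : FormalSum R (FormalSum R X)) : FormalSum R X :=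
  extend (fun q => q) Q

theorem mapSum_eq_extend (f : X → Y) (r : FormalSum R X) :
    mapSum f r = extend (fun x => point (f x)) r := by
  classical
  ext y
  change ∑' x : f ⁻¹' {y}, r x = ∑' x, r x * (Pi.single (f x) 1 : Y → R) y
  rw [tsum_subtype]
  congr 1
  ext x
  by_cases h : f x = y
  · subst h
    simp
  · rw [Set.indicator_of_notMem (by simpa using h), Pi.single_eq_of_ne (Ne.symm h), mul_zero]

theorem extend_point (r : FormalSum R X) : extend point r = r := by
  classical
  ext y
  change ∑' x, r x * (Pi.single x 1 : X → R) y = r y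
  rw [tsum_eq_single y fun x hx => by rw [Pi.single_eq_of_ne hx.symm, mul_zero]]
  simp

theorem extend_apply_point (g : X → FormalSum R Y) (x : X) : extend g (point x) = g x := by
  classical
  ext y
  change ∑' z, (Pi.single x 1 : X → R) z * g z y = g x y
  rw [tsum_eq_single x fun z hz => by rw [Pi.single_eq_of_ne hz, zero_mul]]
  simp

variable [CompleteSpace R]

theorem summable_of_finite {f : X → R}
    (hf : ∀ I : Submodule Rᵐᵒᵖ R, IsOpen (I : Set R) → {x | f x ∉ I}.Finite) : Summable f :=
  haveI := nonarchimedean (R := R)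
  NonarchimedeanAddGroup.summable_of_tendsto_cofinite_zero (tendsto_cofinite_zero_iff.1 hf)

theorem summable_mul (r : FormalSum R X) (g : X → FormalSum R Y) (y : Y) :
    Summable fun x => r x * g x y :=
  summable_of_finite fun I hI =>
    ((finite_mul r.2 (fun x => (g x).2) I hI).image Prod.fst).subset fun x hx =>
      ⟨(x, y), hx, rfl⟩

variable [T2Space R]

theorem extend_extend {Z : Type*} (h : Y → FormalSum R Z) (g : X → FormalSum R Y)
    (r : FormalSum R X) : extend h (extend g r) = extend (fun x => extend h (g x)) r := by
  ext z
  change ∑' y, (∑' x, r x * g x y) * h y z = ∑' x, r x * ∑' y, g x y * h y z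
  have hfin : ∀ I : Submodule Rᵐᵒᵖ R, IsOpen (I : Set R) →
      {p : X × Y | r p.1 * g p.1 p.2 * h p.2 z ∉ I}.Finite := fun I hI =>
    (finite_mul r.2 (fun x => (g x).2) I hI).subset fun p hp hp' =>
      hp (mul_mem_rightIdeal I hp' _)
  have hs := summable_of_finite hfin
  have e1 : ∀ y, (∑' x, r x * g x y) * h y z = ∑' x, r x * g x y * h y z := fun y =>
    ((summable_mul r g y).tsum_mul_right _).symm
  have e2 : ∀ x, r x * ∑' y, g x y * h y z = ∑' y, r x * g x y * h y z := fun x => by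
    rw [← (summable_mul (g x) h z).tsum_mul_left]
    simp only [mul_assoc]
  simp only [e1, e2]
  exact Summable.tsum_comm (f := fun x y => r x * g x y * h y z) hs

theorem openParens_mapSum_extend (g : X → FormalSum R Y) (Q : FormalSum R (FormalSum R X)) :
    openParens (mapSum (extend g) Q) = extend g (openParens Q) := by
  simp only [openParens, mapSum_eq_extend, extend_extend, extend_apply_point]

end FormalSums

section Contramodules

variable (R : Type u) [Ring R] [UniformSpace R] [IsUniformAddGroup R] [IsTopologicalRing R]
  [IsLinearTopology Rᵐᵒᵖ R] [CompleteSpace R] [T2Space R]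

/-- The monad `X ↦ R[[X]]` on the category of sets, with unit `ε` and multiplication `φ`. -/
noncomputable def formalSumMonad : CategoryTheory.Monad (Type u) where
  obj X := FormalSum R X
  map f := ↾(mapSum f)
  map_id X := by
    ext r : 3
    exact (mapSum_eq_extend _ r).trans (extend_point r)
  map_comp f g := by
    ext r : 3
    change mapSum (fun x => g (f x)) r = mapSum g (mapSum f r)
    simp only [mapSum_eq_extend, extend_extend, extend_apply_point]
  η :=
    { app X := ↾point
      naturality X Y f := by
        ext x : 3
        change point (f x) = mapSum f (point x)
        rw [mapSum_eq_extend, extend_apply_point] }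
  μ :=
    { app X := ↾openParens
      naturality X Y f := by
        ext Q : 3
        change openParens (mapSum (mapSum f) Q) = mapSum f (openParens Q)
        simp only [openParens, mapSum_eq_extend, extend_extend, extend_apply_point] }
  assoc X := by
    ext Q : 3
    change openParens (mapSum openParens Q) = openParens (openParens Q)
    simp only [openParens, mapSum_eq_extend, extend_extend, extend_apply_point]
  left_unit X := by
    ext r : 3
    change openParens (point r) = r
    simp only [openParens, extend_apply_point]
  right_unit X := by
    ext r : 3
    change openParens (mapSum point r) = r
    simp only [openParens, mapSum_eq_extend, extend_extend, extend_apply_point, extend_point]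

/-- The category of left `R`-contramodules: algebras over the monad `X ↦ R[[X]]`. -/
abbrev Contramodule : Type (u + 1) := (formalSumMonad R).Algebra

/-- The free left `R`-contramodule with one generator `R[[*]] = R`. -/
noncomputable abbrev freeOne : Contramodule R := (formalSumMonad R).free.obj PUnit.{u + 1}

variable {R}

/-- The map `r · * ↦ (r a) · *` from `R[[*]]` to itself. -/
def mulRight (a : R) (r : FormalSum R PUnit.{u + 1}) : FormalSum R PUnit.{u + 1} :=
  ⟨fun s => r s * a, fun _ _ => Set.toFinite _⟩

theorem mulRight_eq_extend (a : R) :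
    mulRight a = extend (fun _ => ⟨fun _ => a, fun _ _ => Set.toFinite _⟩) := by
  funext r
  ext s
  change r s * a = ∑' x : PUnit, r x * a
  rw [tsum_eq_single s fun x hx => (hx (Subsingleton.elim _ _)).elim]

/-- The left `R`-contramodule morphism `*a : R → R` of right multiplication by `a`, where `R` is
identified with `R[[*]]` by `r ↦ r · *`. -/
noncomputable def rightMul (a : R) : freeOne R ⟶ freeOne R where
  f := ↾(mulRight a)
  h := by
    ext Q : 3
    change openParens (mapSum (mulRight a) Q) = mulRight a (openParens Q)
    rw [mulRight_eq_extend]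
    exact openParens_mapSum_extend _ Q

/-- A left `R`-contramodule `B` is Bass flat if, for some sequence `a₀, a₁, …` in `R`, it is
the direct limit, computed in the category of left `R`-contramodules, of the sequence
`R ⟶ R ⟶ R ⟶ ⋯` of right multiplications by the `aₙ`. -/
def IsBassFlat (B : Contramodule R) : Prop :=
  ∃ (a : ℕ → R)
    (ι : Functor.ofSequence (X := fun _ => freeOne R) (fun n => rightMul (a n)) ⟶
      (Functor.const ℕ).obj B),
    Nonempty (IsColimit (Cocone.mk B ι))

end Contramodules

section Covers

variable {A : Type u} [Category.{v} A]

/-- An `L`-precover of `B` is a morphism `l : P ⟶ B` with `P` in `L` through which every morphism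
to `B` from an object of `L` factors. -/
def IsPrecover (L : ObjectProperty A) {P B : A} (l : P ⟶ B) : Prop :=
  L P ∧ ∀ ⦃P' : A⦄ (l' : P' ⟶ B), L P' → ∃ f : P' ⟶ P, f ≫ l = l'

/-- An `L`-precover `l : P ⟶ B` is an `L`-cover if every endomorphism `f` of `P` such that
`f` followed by `l` equals `l` is an automorphism. -/
def IsCover (L : ObjectProperty A) {P B : A} (l : P ⟶ B) : Prop :=
  IsPrecover L l ∧ ∀ f : P ⟶ P, f ≫ l = l → IsIso f

/-- A projective cover of `B` is a cover of `B` with respect to the class of projective objects. -/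
def HasProjectiveCover (B : A) : Prop :=
  ∃ (P : A) (p : P ⟶ B), IsCover (isProjective A) p

end Covers

end Contra

/-! A Bass flat `B` is generated by elements bₙ subject to the relations bₙ = aₙbₙ₊₁. So it is the
quotient of F = R[[ℕ]] by the infinite combinations of the relations eₙ − aₙeₙ₊₁
(`exists_extend_relation_eq`). Let p : P → B be a projective cover. Since F and P are both
projective, there are maps i : P → F and s : F → P over B. The main point is that p is injective. If
p x = p y, then i x − i y = ∑ zₙ(eₙ − aₙeₙ₊₁) with zₙ → 0. Given an open right ideal I, choose k
with zₙ ∈ I for n ≥ k, and an endomorphism γ of F over B killing the first k relations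
(`exists_annihilating`). The endomorphism of P given by i, then γ, then s lies over B, so the cover
property makes it invertible, and i factors as i, then γ, then some δ. Hence i x − i y is the image
under γ and δ of a sum in which only terms with zₙ ∈ I survive. All its coefficients lie in I. As I
was arbitrary and R is separated, i x = i y, and i is a split monomorphism. Once p is injective, the
relations lift from B to P, which gives a section of p. So B is a retract of P. -/

namespace Contra

/-! ### Additive structure on formal sums and linearity of `extend`. -/

section FormalSumGroup

variable {R : Type u} [Ring R] [UniformSpace R] {X : Type v} {Y : Type w}

variable (R X) in
/-- The families of coefficients converging to zero form a subgroup of `X → R`. -/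
def formalSumSubgroup : AddSubgroup (X → R) where
  carrier := {r | ∀ I : Submodule Rᵐᵒᵖ R, IsOpen (I : Set R) → {x | r x ∉ I}.Finite}
  zero_mem' := fun I _ => by simp
  add_mem' := fun {r s} hr hs I hI => ((hr I hI).union (hs I hI)).subset fun x hx => by
    by_contra h
    simp only [Set.mem_union, Set.mem_ofPred_eq, not_or, not_not] at h
    exact hx (I.add_mem h.1 h.2)
  neg_mem' := fun {r} hr I hI => by simpa using hr I hI

instance : AddCommGroup (FormalSum R X) :=
  inferInstanceAs (AddCommGroup (formalSumSubgroup R X))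

@[simp] theorem FormalSum.zero_apply (x : X) : (0 : FormalSum R X) x = 0 := rfl

@[simp] theorem FormalSum.sub_apply (r s : FormalSum R X) (x : X) : (r - s) x = r x - s x := rfl

variable [IsUniformAddGroup R] [IsLinearTopology Rᵐᵒᵖ R] [IsTopologicalRing R]

theorem extend_apply (g : X → FormalSum R Y) (r : FormalSum R X) (y : Y) :
    extend g r y = ∑' x, r x * g x y := rfl

theorem extend_zero (g : X → FormalSum R Y) : extend g 0 = 0 := by
  ext y
  simp [extend_apply]

theorem extend_zero_fun (r : FormalSum R X) : extend (fun _ => (0 : FormalSum R Y)) r = 0 := by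
  ext y
  simp [extend_apply]

/-- Linear extensions preserve the formal sums with coefficients in an open right ideal. -/
theorem extend_mem (I : Submodule Rᵐᵒᵖ R) (hI : IsOpen (I : Set R)) (g : X → FormalSum R Y)
    {r : FormalSum R X} (hr : ∀ x, r x ∈ I ∨ g x = 0) (y : Y) : extend g r y ∈ I := by
  refine tsum_mem_openRightIdeal I hI fun x => ?_
  rcases hr x with h | h
  · exact mul_mem_rightIdeal I h _
  · simp [h]

/-- The formal sums are separated by the open right ideals. -/
theorem FormalSum.eq_zero_of_forall_mem [T2Space R] {r : FormalSum R X}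
    (h : ∀ I : Submodule Rᵐᵒᵖ R, IsOpen (I : Set R) → ∀ x, r x ∈ I) : r = 0 := by
  ext x
  by_contra hx
  obtain ⟨I, hI, hIU⟩ := (IsLinearTopology.hasBasis_open_submodule (M := R) Rᵐᵒᵖ).mem_iff.1
    (isOpen_ne.mem_nhds (Ne.symm hx) : {z : R | z ≠ r x} ∈ 𝓝 0)
  exact hIU (h I hI x) rfl

variable [CompleteSpace R] [T2Space R]

theorem extend_sub (g : X → FormalSum R Y) (r s : FormalSum R X) :
    extend g (r - s) = extend g r - extend g s := by
  ext y
  simp only [extend_apply, FormalSum.sub_apply, sub_mul]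
  exact (summable_mul r g y).tsum_sub (summable_mul s g y)

theorem extend_sub_fun (g h : X → FormalSum R Y) (r : FormalSum R X) :
    extend (fun x => g x - h x) r = extend g r - extend h r := by
  ext y
  simp only [extend_apply, FormalSum.sub_apply, mul_sub]
  exact (summable_mul r g y).tsum_sub (summable_mul r h y)

theorem extend_mapSum {Z : Type*} (g : Y → FormalSum R Z) (f : X → Y) (r : FormalSum R X) :
    extend g (mapSum f r) = extend (fun x => g (f x)) r := by
  simp only [mapSum_eq_extend, extend_extend, extend_apply_point]

theorem mapSum_mapSum {Z : Type*} (g : Y → Z) (f : X → Y) (r : FormalSum R X) :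
    mapSum g (mapSum f r) = mapSum (fun x => g (f x)) r := by
  simp only [mapSum_eq_extend, extend_extend, extend_apply_point]

theorem mapSum_point (f : X → Y) (x : X) : mapSum f (point x : FormalSum R X) = point (f x) := by
  rw [mapSum_eq_extend, extend_apply_point]

theorem mapSum_sub (f : X → Y) (r s : FormalSum R X) :
    mapSum f (r - s) = mapSum f r - mapSum f s := by
  simp only [mapSum_eq_extend, extend_sub]

theorem mapSum_zero (f : X → Y) : mapSum f (0 : FormalSum R X) = 0 := by
  rw [mapSum_eq_extend, extend_zero]

theorem openParens_mapSum (g : X → FormalSum R Y) (r : FormalSum R X) :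
    openParens (mapSum g r) = extend g r :=
  extend_mapSum _ _ _

end FormalSumGroup

/-! ### Infinite linear combinations in contramodules and free contramodules. -/

section Combinations

variable {R : Type u} [Ring R] [UniformSpace R] [IsUniformAddGroup R] [IsTopologicalRing R]
  [IsLinearTopology Rᵐᵒᵖ R] [CompleteSpace R] [T2Space R]

/-- The value in a contramodule `A` of the infinite linear combination `∑ r_x g(x)`. -/
noncomputable def comb (A : Contramodule R) {X : Type u} (g : X → A.A) (r : FormalSum R X) : A.A :=
  A.a (mapSum g r : FormalSum R A.A)

variable {A B : Contramodule R} {X Y : Type u}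

theorem comb_point (g : X → A.A) (x : X) : comb A g (point x) = g x := by
  rw [comb, mapSum_point]
  exact ConcreteCategory.congr_hom A.unit (g x)

/-- This is the associativity axiom of the algebra over the monad, in elementwise form. -/
theorem comb_extend (g : Y → A.A) (f : X → FormalSum R Y) (r : FormalSum R X) :
    comb A g (extend f r) = comb A (fun x => comb A g (f x)) r := by
  have h : A.a (openParens (mapSum (fun x => mapSum g (f x)) r) : FormalSum R A.A) =
      A.a (mapSum (fun q : FormalSum R A.A => A.a q) (mapSum (fun x => mapSum g (f x)) r) :
        FormalSum R A.A) :=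
    ConcreteCategory.congr_hom A.assoc (mapSum (fun x => mapSum g (f x)) r : FormalSum R _)
  rw [openParens_mapSum, mapSum_mapSum] at h
  simp only [comb]
  rw [← h, mapSum_eq_extend, extend_extend]
  simp only [mapSum_eq_extend]

theorem comb_mapSum (g : Y → A.A) (f : X → Y) (r : FormalSum R X) :
    comb A g (mapSum f r) = comb A (fun x => g (f x)) r := by
  rw [comb, mapSum_mapSum, comb]

theorem hom_comb (φ : A ⟶ B) (g : X → A.A) (r : FormalSum R X) :
    φ.f (comb A g r) = comb B (fun x => φ.f (g x)) r := by
  have h : B.a (mapSum (fun x => φ.f x) (mapSum g r) : FormalSum R B.A) =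
    φ.f (A.a (mapSum g r : FormalSum R A.A)) :=
    ConcreteCategory.congr_hom φ.h (mapSum g r : FormalSum R A.A)
  rw [mapSum_mapSum] at h
  exact h.symm

theorem hom_ext_apply {φ ψ : A ⟶ B} (h : ∀ x, φ.f x = ψ.f x) : φ = ψ := by
  ext x
  exact h x

/-- The free contramodule `R[[X]]`. -/
noncomputable abbrev free (R : Type u) [Ring R] [UniformSpace R] [IsUniformAddGroup R]
    [IsTopologicalRing R] [IsLinearTopology Rᵐᵒᵖ R] [CompleteSpace R] [T2Space R] (X : Type u) :
    Contramodule R :=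
  (formalSumMonad R).free.obj X

theorem comb_free (g : X → FormalSum R Y) (r : FormalSum R X) :
    comb (free R Y) g r = extend g r :=
  openParens_mapSum g r

/-- A map compatible with infinite linear combinations is a contramodule morphism. -/
def homMk (f : A.A → B.A)
    (h : ∀ r : FormalSum R A.A, comb B f r = f (comb A (fun x => x) r)) : A ⟶ B where
  f := ↾f
  h := by
    ext r : 3
    refine (h r).trans (congrArg f ?_)
    exact congrArg (fun s : FormalSum R A.A => A.a s)
      ((mapSum_eq_extend (fun x => x) _).trans (extend_point _))

/-- The morphism from a free contramodule with prescribed values on the generators. -/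
noncomputable def freeDesc (A : Contramodule R) (g : X → A.A) : free R X ⟶ A :=
  homMk (A := free R X) (comb A g) fun r =>
    (comb_extend g (fun x => x) r).symm.trans
      (congrArg (comb A g) (comb_free (fun x => x) r).symm)

theorem free_hom_apply (φ : free R X ⟶ A) (r : FormalSum R X) :
    φ.f r = comb A (fun x => φ.f (point x : FormalSum R X)) r :=
  (congrArg _ ((comb_free point r).trans (extend_point r)).symm).trans (hom_comb φ point r)

theorem free_hom_ext {φ ψ : free R X ⟶ A}
    (h : ∀ x, φ.f (point x : FormalSum R X) = ψ.f (point x : FormalSum R X)) : φ = ψ :=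
  hom_ext_apply fun r =>
    (free_hom_apply φ r).trans ((congrArg (comb A · r) (funext h)).trans (free_hom_apply ψ r).symm)

end Combinations

/-! ### Quotients of free contramodules. -/

section Quotients

variable {R : Type u} [Ring R] [UniformSpace R] [IsUniformAddGroup R] [IsTopologicalRing R]
  [IsLinearTopology Rᵐᵒᵖ R] [CompleteSpace R] [T2Space R] {X : Type u}

/-- A subgroup of `R[[X]]` is a subcontramodule if it is closed under infinite combinations. -/
def IsSubcontramodule (K : AddSubgroup (FormalSum R X)) : Prop :=
  ∀ ⦃Y : Type u⦄ (g : Y → FormalSum R X) (r : FormalSum R Y), (∀ y, g y ∈ K) → extend g r ∈ K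

variable {K : AddSubgroup (FormalSum R X)}

/-- The difference of the two sides is an infinite combination of the g y − h y, all of which lie in
`K`. Thus combinations of cosets do not depend on the representatives. -/
theorem IsSubcontramodule.mk_extend_congr (hK : IsSubcontramodule K) {Y : Type u} {g h : Y → FormalSum R X}
    (hgh : ∀ y, (g y : FormalSum R X ⧸ K) = h y) (r : FormalSum R Y) :
    (extend g r : FormalSum R X ⧸ K) = extend h r := by
  rw [← sub_eq_zero, ← QuotientAddGroup.mk_sub, ← extend_sub_fun, QuotientAddGroup.eq_zero_iff]
  refine hK _ _ fun y => ?_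
  rw [← QuotientAddGroup.eq_zero_iff, QuotientAddGroup.mk_sub, sub_eq_zero, hgh]

variable (K) in
/-- The infinite linear combinations of cosets, computed on representatives. -/
noncomputable def combCosets (r : FormalSum R (FormalSum R X ⧸ K)) : FormalSum R X ⧸ K :=
  (extend Quotient.out r : FormalSum R X)

theorem combCosets_mapSum (hK : IsSubcontramodule K) {Y : Type u} (g : Y → FormalSum R X)
    (r : FormalSum R Y) :
    combCosets K (mapSum (fun y => (g y : FormalSum R X ⧸ K)) r) =
      (extend g r : FormalSum R X) := by
  rw [combCosets, extend_mapSum]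
  exact hK.mk_extend_congr (fun y => Quotient.out_eq _) r

theorem combCosets_openParens (hK : IsSubcontramodule K)
    (Q : FormalSum R (FormalSum R (FormalSum R X ⧸ K))) :
    combCosets K (openParens Q) = combCosets K (mapSum (combCosets K) Q) := by
  refine Eq.trans ?_ (combCosets_mapSum hK (extend Quotient.out) Q).symm
  rw [combCosets, openParens, extend_extend]

/-- The quotient of the free contramodule `R[[X]]` by a subcontramodule. -/
noncomputable def quotient (hK : IsSubcontramodule K) : Contramodule R where
  A := FormalSum R X ⧸ K
  a := ↾(combCosets K)
  unit := by
    ext c : 3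
    change ((extend Quotient.out (point c) : FormalSum R X) : FormalSum R X ⧸ K) = c
    rw [extend_apply_point]
    exact Quotient.out_eq c
  assoc := by
    ext Q : 3
    exact combCosets_openParens hK Q

/-- The projection from the free contramodule `R[[X]]` to its quotient. -/
def quotient.mk (hK : IsSubcontramodule K) (r : FormalSum R X) : (quotient hK).A :=
  (r : FormalSum R X ⧸ K)

theorem quotient.mk_eq_mk {hK : IsSubcontramodule K} {r s : FormalSum R X} :
    quotient.mk hK r = quotient.mk hK s ↔ r - s ∈ K := by
  rw [← QuotientAddGroup.eq_zero_iff, QuotientAddGroup.mk_sub, sub_eq_zero]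
  rfl

theorem comb_quotient (hK : IsSubcontramodule K) {Y : Type u} (g : Y → FormalSum R X)
    (r : FormalSum R Y) :
    comb (quotient hK) (fun y => quotient.mk hK (g y)) r = quotient.mk hK (extend g r) :=
  combCosets_mapSum hK g r

end Quotients

/-! ### Surjectivity of epimorphisms and projectivity of free contramodules. -/

section Projectivity

variable {R : Type u} [Ring R] [UniformSpace R] [IsUniformAddGroup R] [IsTopologicalRing R]
  [IsLinearTopology Rᵐᵒᵖ R] [CompleteSpace R] [T2Space R] {A B : Contramodule R} {X : Type u}

/-- No subtraction is defined on `A` itself, so the difference u − v of two values is written as the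
value of the formal sum 1·u − 1·v. -/
theorem comb_sub (g : X → A.A) (r s : FormalSum R X) :
    comb A g (r - s) = comb A (fun x => x) (point (comb A g r) - point (comb A g s)) := by
  have h : r - s = extend (fun x => x) (point r - point s : FormalSum R (FormalSum R X)) := by
    rw [extend_sub, extend_apply_point, extend_apply_point]
  have h' : (point (comb A g r) - point (comb A g s) : FormalSum R A.A) =
      mapSum (comb A g) (point r - point s) := by
    rw [mapSum_sub, mapSum_point, mapSum_point]
  rw [h', comb_mapSum, h, comb_extend]

/-- The linear combinations of elements of `B` with value in the image of `e : A ⟶ B`. -/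
def rangeSubgroup (e : A ⟶ B) : AddSubgroup (FormalSum R B.A) :=
  AddSubgroup.ofSub {z | ∃ a, e.f a = comb B (fun x => x) z}
    ⟨0, comb A (fun x => x) 0, by rw [hom_comb, comb, comb, mapSum_zero, mapSum_zero]⟩
    (by
      rintro z ⟨a, ha⟩ w ⟨b, hb⟩
      refine ⟨comb A (fun x => x) (point a - point b), ?_⟩
      rw [← sub_eq_add_neg, comb_sub (fun x => x) z, ← ha, ← hb, hom_comb,
        ← comb_mapSum (fun x => x) e.f, mapSum_sub, mapSum_point, mapSum_point])

theorem mem_rangeSubgroup {e : A ⟶ B} {z : FormalSum R B.A} :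
    z ∈ rangeSubgroup e ↔ ∃ a, e.f a = comb B (fun x => x) z := Iff.rfl

theorem isSubcontramodule_rangeSubgroup (e : A ⟶ B) : IsSubcontramodule (rangeSubgroup e) := by
  intro Y g r hg
  choose γ hγ using fun y => mem_rangeSubgroup.1 (hg y)
  refine mem_rangeSubgroup.2 ⟨comb A γ r, ?_⟩
  rw [hom_comb, comb_extend]
  simp only [hγ]

/-- The cokernel of `e` is built as a quotient of R[[B]]. The projection `φ` and the zero map `ψ`
agree after `e`, hence are equal, and they agree at b only if b is in the image. -/
theorem surjective_of_epi (e : A ⟶ B) [Epi e] : Function.Surjective e.f := by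
  have hK := isSubcontramodule_rangeSubgroup e
  let φ : B ⟶ quotient hK := homMk (fun b => quotient.mk hK (point b)) fun r => by
    rw [comb_quotient hK, extend_point, eq_comm, quotient.mk_eq_mk, mem_rangeSubgroup]
    refine ⟨comb A (fun x => x) 0, ?_⟩
    rw [comb_sub, comb_point, sub_self, hom_comb, comb, comb, mapSum_zero, mapSum_zero]
  let ψ : B ⟶ quotient hK := homMk (fun _ => quotient.mk hK 0) fun r => by
    rw [comb_quotient hK, extend_zero_fun]
  have mem_iff (b : B.A) : φ.f b = ψ.f b ↔ ∃ a, e.f a = b := by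
    refine quotient.mk_eq_mk.trans ?_
    rw [sub_zero, mem_rangeSubgroup, comb_point (fun x => x) b]
  have h : φ = ψ := by
    rw [← cancel_epi e]
    exact hom_ext_apply fun a => (mem_iff (e.f a)).2 ⟨a, rfl⟩
  exact fun b => (mem_iff b).1 (by rw [h])

instance projective_free : Projective (free R X) where
  factors {E Z} f e he := by
    choose σ hσ using surjective_of_epi e
    refine ⟨freeDesc E fun x => σ (f.f (point x : FormalSum R X)), free_hom_ext fun x => ?_⟩
    change e.f (comb E _ (point x)) = _
    rw [comb_point, hσ]

end Projectivity

/-! ### Bass flat contramodules and their projective covers. -/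

section BassFlat

variable {R : Type u} [Ring R] [UniformSpace R] [IsUniformAddGroup R] [IsTopologicalRing R]
  [IsLinearTopology Rᵐᵒᵖ R] [CompleteSpace R] [T2Space R] {A B : Contramodule R} {X : Type u}

/-- The element `r · *` of the free contramodule with one generator. -/
def scalar (r : R) : FormalSum R PUnit.{u + 1} := ⟨fun _ => r, fun _ _ => Set.toFinite _⟩

theorem mulRight_point (r : R) : mulRight r (point PUnit.unit) = scalar r := by
  rw [mulRight_eq_extend]
  exact extend_apply_point (fun _ => scalar r) PUnit.unit

/-- Sequences `x` in `A` with `xₙ = aₙ xₙ₊₁`. -/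
def IsDivisionSequence (a : ℕ → R) (x : ULift.{u} ℕ → A.A) : Prop :=
  ∀ n : ℕ, x ⟨n⟩ = comb A (fun _ => x ⟨n + 1⟩) (scalar (a n))

/-- `b` is a universal sequence with `bₙ = aₙ bₙ₊₁`. -/
structure IsUniversalDivisionSequence (a : ℕ → R) (b : ULift.{u} ℕ → B.A) : Prop where
  isDivisionSequence : IsDivisionSequence a b
  exists_desc : ∀ ⦃A : Contramodule R⦄ (x : ULift.{u} ℕ → A.A), IsDivisionSequence a x →
    ∃ φ : B ⟶ A, ∀ n, φ.f (b n) = x n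
  hom_ext : ∀ ⦃A : Contramodule R⦄ (φ ψ : B ⟶ A), (∀ n, φ.f (b n) = ψ.f (b n)) → φ = ψ

/-- A morphism out of R is determined by the image of the generator, so a cocone on the sequence
amounts to elements xₙ with xₙ = aₙxₙ₊₁. -/
theorem IsBassFlat.exists_isUniversalDivisionSequence (hB : IsBassFlat B) :
    ∃ (a : ℕ → R) (b : ULift.{u} ℕ → B.A), IsUniversalDivisionSequence a b := by
  obtain ⟨a, ι, ⟨hι⟩⟩ := hB
  let gen : FormalSum R PUnit.{u + 1} := point PUnit.unit
  refine ⟨a, fun n => (ι.app n.down).f gen, ⟨fun n => ?_, fun A x hx => ?_, fun A φ ψ h => ?_⟩⟩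
  · have h := ι.naturality (homOfLE (Nat.le_add_right n 1))
    rw [Functor.ofSequence_map_homOfLE_succ] at h
    have h' : (ι.app (n + 1)).f (mulRight (a n) gen) = (ι.app n).f gen :=
      congrArg (fun χ : freeOne R ⟶ B => χ.f gen) (h.trans (Category.comp_id _))
    rw [mulRight_point] at h'
    exact h'.symm.trans (free_hom_apply (ι.app (n + 1) : freeOne R ⟶ B) (scalar (a n)))
  · let κ : Functor.ofSequence (X := fun _ => freeOne R) (fun n => rightMul (a n)) ⟶
        (Functor.const ℕ).obj A :=
      NatTrans.ofSequence (fun n => freeDesc A fun _ => x ⟨n⟩) fun n => by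
        rw [Functor.ofSequence_map_homOfLE_succ]
        refine free_hom_ext fun s => ?_
        change comb A (fun _ => x ⟨n + 1⟩) (mulRight (a n) (point s)) =
          comb A (fun _ => x ⟨n⟩) (point s)
        rw [comb_point, mulRight_point, hx n]
    refine ⟨hι.desc (Cocone.mk A κ), fun n => ?_⟩
    have h := congrArg (fun χ : freeOne R ⟶ A => χ.f gen) (hι.fac (Cocone.mk A κ) n.down)
    exact h.trans (comb_point _ _)
  · exact hι.hom_ext fun n => free_hom_ext fun s => h ⟨n⟩

/-- The generators `eₙ - aₙ eₙ₊₁` of the relations between the elements of a sequence `x`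
with `xₙ = aₙ xₙ₊₁`. -/
noncomputable def relation (a : ℕ → R) (n : ULift.{u} ℕ) : FormalSum R (ULift.{u} ℕ) :=
  point n - extend (fun _ => point ⟨n.down + 1⟩) (scalar (a n.down))

theorem extend_relation (a : ℕ → R) {X : Type*} (g : ULift.{u} ℕ → FormalSum R X)
    (n : ULift.{u} ℕ) :
    extend g (relation a n) = g n - extend (fun _ => g ⟨n.down + 1⟩) (scalar (a n.down)) := by
  rw [relation, extend_sub, extend_apply_point, extend_extend]
  simp only [extend_apply_point]

/-- The infinite linear combinations of the relations `eₙ - aₙ eₙ₊₁`. -/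
noncomputable def relationSubgroup (a : ℕ → R) : AddSubgroup (FormalSum R (ULift.{u} ℕ)) :=
  (AddMonoidHom.ofMapSub (extend (relation a)) (extend_sub _)).range

theorem mem_relationSubgroup {a : ℕ → R} {z : FormalSum R (ULift.{u} ℕ)} :
    z ∈ relationSubgroup a ↔ ∃ y, extend (relation a) y = z := Iff.rfl

theorem isSubcontramodule_relationSubgroup (a : ℕ → R) :
    IsSubcontramodule (relationSubgroup a) := by
  intro Y g r hg
  choose γ hγ using fun y => mem_relationSubgroup.1 (hg y)
  refine mem_relationSubgroup.2 ⟨extend γ r, ?_⟩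
  rw [extend_extend]
  simp only [hγ]

namespace IsUniversalDivisionSequence

variable {a : ℕ → R} {b : ULift.{u} ℕ → B.A}

/-- The classes of the eₙ modulo the relations form a division sequence, so universality gives a map
from `B` to the quotient taking the value of a formal sum back to its class. -/
theorem exists_extend_relation_eq (hb : IsUniversalDivisionSequence a b)
    {x y : FormalSum R (ULift.{u} ℕ)} (h : comb B b x = comb B b y) :
    ∃ z, extend (relation a) z = x - y := by
  have hK := isSubcontramodule_relationSubgroup a
  obtain ⟨φ, hφ⟩ := hb.exists_desc (A := quotient hK) (fun n => quotient.mk hK (point n))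
    fun n => by
      rw [comb_quotient, quotient.mk_eq_mk, mem_relationSubgroup]
      exact ⟨point ⟨n⟩, extend_apply_point _ _⟩
  have key (z : FormalSum R (ULift.{u} ℕ)) : φ.f (comb B b z) = quotient.mk hK z := by
    rw [hom_comb]
    simp only [hφ]
    rw [comb_quotient, extend_point]
  exact mem_relationSubgroup.1 (quotient.mk_eq_mk.1 (by rw [← key x, ← key y, h]))

theorem epi_freeDesc (hb : IsUniversalDivisionSequence a b) : Epi (freeDesc B b) where
  left_cancellation φ ψ h := hb.hom_ext φ ψ fun n => by
    have h' : φ.f (comb B b (point n)) = ψ.f (comb B b (point n)) :=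
      congrArg (fun χ : free R (ULift.{u} ℕ) ⟶ _ => χ.f (point n : FormalSum R _)) h
    rwa [comb_point] at h'

end IsUniversalDivisionSequence

/-- There is an endomorphism of the free contramodule over its quotient `B` that annihilates the
first `k` relations. -/
theorem IsDivisionSequence.exists_annihilating {a : ℕ → R} {b : ULift.{u} ℕ → B.A}
    (hb : IsDivisionSequence a b) (k : ℕ) :
    ∃ g : ULift.{u} ℕ → FormalSum R (ULift.{u} ℕ), (∀ n, k ≤ n.down → g n = point n) ∧
      (∀ n, n.down < k → extend g (relation a n) = 0) ∧ ∀ n, comb B b (g n) = b n := by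
  classical
  induction k with
  | zero => exact ⟨point, fun _ _ => rfl, fun n hn => absurd hn (Nat.not_lt_zero _),
      fun n => comb_point _ _⟩
  | succ k ih =>
    obtain ⟨g, hg, hg', hgb⟩ := ih
    -- Replacing eₖ by aₖeₖ₊₁ kills the relation of index k and preserves values in `B`. The
    -- composite sends eₙ with n ≤ k to aₙ⋯aₖeₖ₊₁.
    let v : ULift.{u} ℕ → FormalSum R (ULift.{u} ℕ) :=
      Function.update point ⟨k⟩ (extend (fun _ => point ⟨k + 1⟩) (scalar (a k)))
    have v_of_ne {n : ULift.{u} ℕ} (hn : n.down ≠ k) : v n = point n :=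
      Function.update_of_ne (fun h => hn (congrArg ULift.down h)) _ _
    have v_self : v ⟨k⟩ = extend (fun _ => point ⟨k + 1⟩) (scalar (a k)) :=
      Function.update_self _ _ _
    refine ⟨fun n => extend v (g n), fun n hn => ?_, fun n hn => ?_, fun n => ?_⟩
    · dsimp only
      rw [hg n (by omega), extend_apply_point, v_of_ne (by omega)]
    · rw [← extend_extend]
      rcases Nat.lt_succ_iff_lt_or_eq.1 hn with h | h
      · rw [hg' n h, extend_zero]
      · obtain rfl : n = ⟨k⟩ := ULift.ext _ _ h
        rw [extend_relation, hg ⟨k⟩ le_rfl, hg ⟨k + 1⟩ (Nat.le_succ k)]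
        change extend v (relation a ⟨k⟩) = 0
        rw [extend_relation, v_self, v_of_ne (Nat.succ_ne_self k), sub_self]
    · have hv : (fun m => comb B b (v m)) = b := by
        funext m
        by_cases h : m.down = k
        · obtain rfl : m = ⟨k⟩ := ULift.ext _ _ h
          rw [v_self, comb_extend]
          simp only [comb_point]
          exact (hb k).symm
        · rw [v_of_ne h, comb_point]
      rw [comb_extend, hv, hgb]

theorem exists_forall_le_mem (y : FormalSum R (ULift.{u} ℕ)) (I : Submodule Rᵐᵒᵖ R)
    (hI : IsOpen (I : Set R)) : ∃ k, ∀ n, k ≤ n.down → y n ∈ I := by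
  obtain ⟨k, hk⟩ := ((y.2 I hI).image ULift.down).bddAbove
  refine ⟨k + 1, fun n hn => ?_⟩
  by_contra h
  have := hk ⟨n, h, rfl⟩
  omega

theorem IsUniversalDivisionSequence.injective_of_isCover {a : ℕ → R} {b : ULift.{u} ℕ → B.A}
    (hb : IsUniversalDivisionSequence a b) {P : Contramodule R} {p : P ⟶ B}
    (hp : IsCover (isProjective (Contramodule R)) p) : Function.Injective p.f := by
  have : Epi (freeDesc B b) := hb.epi_freeDesc
  have : Projective P := hp.1.1
  obtain ⟨s, hs⟩ := hp.1.2 (freeDesc B b) (projective_free (R := R) (X := ULift.{u} ℕ))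
  let i : P ⟶ free R (ULift.{u} ℕ) := Projective.factorThru p (freeDesc B b)
  have hi : i ≫ freeDesc B b = p := Projective.factorThru_comp _ _
  -- First use of the cover property: it makes `i` a split monomorphism.
  have : IsIso (i ≫ s) := hp.2 _ (by rw [Category.assoc, hs, hi])
  have i_injective : Function.Injective i.f := fun x y hxy => by
    have h (z : P.A) : (inv (i ≫ s)).f (s.f (i.f z)) = z :=
      congrArg (fun χ : P ⟶ P => χ.f z) (IsIso.hom_inv_id (i ≫ s))
    rw [← h x, hxy, h]
  intro x y hxy
  refine i_injective ?_
  let coord (z : P.A) : FormalSum R (ULift.{u} ℕ) := i.f z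
  have hcoord (z : P.A) : comb B b (coord z) = p.f z :=
    congrArg (fun χ : P ⟶ B => χ.f z) hi
  obtain ⟨z, hz⟩ := hb.exists_extend_relation_eq ((hcoord x).trans (hxy.trans (hcoord y).symm))
  suffices h : coord x - coord y = 0 from sub_eq_zero (G := FormalSum R _).1 h
  refine FormalSum.eq_zero_of_forall_mem fun I hI => ?_
  obtain ⟨k, hk⟩ := exists_forall_le_mem z I hI
  obtain ⟨g, -, hg, hgb⟩ := hb.isDivisionSequence.exists_annihilating k
  let γ : free R (ULift.{u} ℕ) ⟶ free R (ULift.{u} ℕ) := freeDesc _ g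
  have hγ : γ ≫ freeDesc B b = freeDesc B b := free_hom_ext fun n => by
    refine Eq.trans (congrArg (comb B b) (comb_point (A := free R (ULift.{u} ℕ)) g n)) ?_
    exact (hgb n).trans (comb_point b n).symm
  -- Second use, now with `γ` depending on I: the first k relations can be discarded without losing
  -- information about elements of `P`.
  have : IsIso (i ≫ γ ≫ s) := hp.2 _ (by simp only [Category.assoc, hs, hγ, hi])
  let δ : free R (ULift.{u} ℕ) ⟶ free R (ULift.{u} ℕ) := s ≫ inv (i ≫ γ ≫ s) ≫ i
  have hδ : i ≫ γ ≫ δ = i := by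
    have h := congrArg (· ≫ i) (IsIso.hom_inv_id (i ≫ γ ≫ s))
    simpa only [Category.assoc, Category.id_comp] using h
  let d (n : ULift.{u} ℕ) : FormalSum R (ULift.{u} ℕ) := δ.f (point n : FormalSum R _)
  have coord_eq (w : P.A) : coord w = extend d (extend g (coord w)) := by
    have h : coord w = δ.f (γ.f (i.f w)) :=
      (congrArg (fun χ : P ⟶ free R (ULift.{u} ℕ) => χ.f w) hδ).symm
    refine h.trans ((free_hom_apply δ _).trans ((comb_free d _).trans ?_))
    exact congrArg (extend d) (comb_free g (coord w))
  rw [coord_eq x, coord_eq y, ← extend_sub, ← extend_sub, ← hz,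
    extend_extend g (relation a)]
  -- Right multiplication by the unknown coefficients of `d` and `g` preserves the right ideal I, so
  -- nothing about `δ` needs to be controlled.
  refine extend_mem I hI _ fun m => Or.inl (extend_mem I hI _ (fun n => ?_) m)
  exact (le_or_gt k n.down).imp (hk n) (hg n)

theorem IsUniversalDivisionSequence.projective_of_isCover {a : ℕ → R} {b : ULift.{u} ℕ → B.A}
    (hb : IsUniversalDivisionSequence a b) {P : Contramodule R} {p : P ⟶ B}
    (hp : IsCover (isProjective (Contramodule R)) p) : Projective B := by
  have p_injective := hb.injective_of_isCover hp
  have : Projective P := hp.1.1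
  obtain ⟨s, hs⟩ := hp.1.2 (freeDesc B b) (projective_free (R := R) (X := ULift.{u} ℕ))
  let x (n : ULift.{u} ℕ) : P.A := s.f (point n : FormalSum R _)
  have hx (n : ULift.{u} ℕ) : p.f (x n) = b n :=
    (congrArg (fun χ : free R (ULift.{u} ℕ) ⟶ B => χ.f (point n : FormalSum R _)) hs).trans
      (comb_point _ _)
  -- Lifts of the bₙ need not satisfy the relations in general; they do here because `p` is
  -- injective.
  obtain ⟨φ, hφ⟩ := hb.exists_desc x fun n => p_injective (by
    rw [hom_comb]
    simp only [hx]
    exact hb.isDivisionSequence n)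
  have hφp : φ ≫ p = 𝟙 B := hb.hom_ext _ _ fun n => by
    change p.f (φ.f (b n)) = b n
    rw [hφ, hx]
  exact Retract.projective { i := φ, r := p, retract := hφp }

end BassFlat

end Contra

theorem mainTheorem10 {R : Type u} [Ring R] [UniformSpace R] [IsUniformAddGroup R]
    [IsTopologicalRing R] [IsLinearTopology Rᵐᵒᵖ R] [CompleteSpace R] [T2Space R]
    (B : Contra.Contramodule R) (hB : Contra.IsBassFlat B)
    (hcover : Contra.HasProjectiveCover B) :
    Projective B := by
  obtain ⟨a, b, hb⟩ := hB.exists_isUniversalDivisionSequence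
  obtain ⟨P, p, hp⟩ := hcover
  exact hb.projective_of_isCover hp
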